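/- Consider the forest fire model on $\mathbb{Z}_+=\{0,1,2,\dots\}$ with instantaneous spread of the fire and constant burning time $\theta>0$. Initially all sites are vacant. Whenever a site is vacant, a tree appears there after an exponentially distributed time with mean $1$, all these waiting times being independent. A tree at $0$ starts burning as soon as it appears. A tree present at $x+1$ which is not burning catches fire at the first time at which the site $x$ is burning (that is, immediately if $x$ is burning when the tree appears). A tree which catches fire at time $s$ burns during $[s,s+\theta)$, and its site becomes vacant at time $s+\theta$. Let $f_{x,i}$ be the time at which the site $x$ catches fire for the $i$-th time. The $k$-th fire consists of the $k$-th burning tree at $0$ and all the trees which catch fire, directly or through other trees, from it. Let $m_1$ be the largest site burnt by the first fire and, for $i\ge 2$, let $m_i$ be the largest site burnt by the first fire which reaches beyond $m_{i-1}$ (with $m_i=\infty$ if that fire never stops or if $m_{i-1}=\infty$). Assume the following (conjectured) property: there is a constant $c\ge 1$ such that almost surely there exists a (possibly random) $\kappa$ with $f_{m_i,2}\le c\log m_i$ for all $i\ge\kappa$ (the inequality being regarded as true where $m_i=\infty$). Then there is a constant $M>0$ such that, almost surely, $f_{n,1}\le M\log n$ for all sufficiently large $n$; in particular $f_{n,1}=O(\log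 n)$ almost surely. -/

import Mathlib

open MeasureTheory ProbabilityTheory Filter

/-!
The forest fire model on the non-negative integers with ignition at `0`, instantaneous spread of
the fire (`Δ = 0`) and a constant burning time `θ`. The randomness consists of the waiting times
`ξ x i`: the time that the `i`-th tree at site `x` needs to appear, counted from the moment at which
the site is vacant. Trees and fires are numbered from `0`, so that `fireTime θ ξ x 0` is the time
at which site `x` burns for the first time and `fireTime θ ξ x 1` the time at which it does so for
the second time.
-/

namespace ForestFire

/-- The times at which the successive trees of one site catch fire. A tree that appears at time `t`
catches fire at time `ignite t`; it burns for `θ` units of time, then the site is vacant and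
the next tree needs the time `w (i + 1)` to appear. -/
noncomputable def burnStarts (θ : ℝ) (ignite : ℝ → ℝ) (w : ℕ → ℝ) : ℕ → ℝ
  | 0 => ignite (w 0)
  | i + 1 => ignite (burnStarts θ ignite w i + θ + w (i + 1))

/-- If the left neighbour of a site burns during the intervals `[f i, f i + θ)`, this is the number
of the first of these intervals that is not over at time `t`. -/
noncomputable def firstActive (θ : ℝ) (f : ℕ → ℝ) (t : ℝ) : ℕ :=
  sInf {i | t < f i + θ}

/-- The time at which a tree that appears at time `t` catches fire from its left neighbour, which
burns during the intervals `[f i, f i + θ)`: the first time from `t` on at which the left neighbour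
burns. -/
noncomputable def igniteTime (θ : ℝ) (f : ℕ → ℝ) (t : ℝ) : ℝ :=
  max t (f (firstActive θ f t))

/-- `fireTime θ ξ x i` is the time at which site `x` catches fire for the time number `i`
(counted from `0`). At the origin trees burn as soon as they appear. -/
noncomputable def fireTime (θ : ℝ) (ξ : ℕ → ℕ → ℝ) : ℕ → ℕ → ℝ
  | 0 => burnStarts θ id (ξ 0)
  | x + 1 => burnStarts θ (igniteTime θ (fireTime θ ξ x)) (ξ (x + 1))

/-- The time at which tree number `i` (counted from `0`) appears at site `x`. -/
noncomputable def treeTime (θ : ℝ) (ξ : ℕ → ℕ → ℝ) (x : ℕ) : ℕ → ℝ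
  | 0 => ξ x 0
  | i + 1 => fireTime θ ξ x i + θ + ξ x (i + 1)

/-- The number `k` of the fire (counted from `0` in the order in which the fires start at the
origin) that burns tree number `i` at site `x`. Tree number `i` at site `x + 1` is burnt by the same
fire as the tree at `x` from which it catches fire. -/
noncomputable def fireLabel (θ : ℝ) (ξ : ℕ → ℕ → ℝ) : ℕ → ℕ → ℕ
  | 0, k => k
  | x + 1, i => fireLabel θ ξ x (firstActive θ (fireTime θ ξ x) (treeTime θ ξ (x + 1) i))

/-- The location of the tree farthest from the origin that is burnt by fire number `k`; it is `⊤`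
if the fire continues indefinitely. -/
noncomputable def extent (θ : ℝ) (ξ : ℕ → ℕ → ℝ) (k : ℕ) : ℕ∞ :=
  sSup {y : ℕ∞ | ∃ x i : ℕ, y = (x : ℕ∞) ∧ fireLabel θ ξ x i = k}

open Classical in
/-- The successive maxima reached by the fires, numbered from `0`: the extent of the first fire,
then recursively the extent of the first fire that reaches beyond the previous maximum; once a
maximum is `⊤`, so are all later ones. -/
noncomputable def succMax (θ : ℝ) (ξ : ℕ → ℕ → ℝ) : ℕ → ℕ∞
  | 0 => extent θ ξ 0
  | i + 1 =>
    if succMax θ ξ i = ⊤ then ⊤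
    else extent θ ξ (sInf {k | succMax θ ξ i < extent θ ξ k})

/-- For some constant `c ≥ 1`, almost surely, for all but finitely many `i` the second fire at the
`i`-th successive maximum `m` (if finite) occurs not later than at time `c * log m`. -/
def SecondFireConjecture {Ω : Type*} [MeasurableSpace Ω] (P : Measure Ω) (θ : ℝ)
    (ξ : ℕ → ℕ → Ω → ℝ) : Prop :=
  ∃ c : ℝ, 1 ≤ c ∧ ∀ᵐ ω ∂P, ∃ κ : ℕ, ∀ i ≥ κ, ∀ m : ℕ,
    succMax θ (fun x j => ξ x j ω) i = (m : ℕ∞) →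
      fireTime θ (fun x j => ξ x j ω) m 1 ≤ c * Real.log m

end ForestFire

/-! Compare the first fires at n and n + 1. If the first tree at n + 1 appears before the first fire
at n is over, then n + 1 first burns at the later of that appearance and that fire, and by
Borel–Cantelli the appearance is eventually at most (3/2) log n. Otherwise the fire stops at n, so n
is a successive maximum (`exists_succMax_eq`) and the conjecture puts the second fire at n before c
log n.

By that second fire n + 1 has burnt, because its tree is already there: the second fire at n waits
for a first tree at a site up to n/2 and then for a second tree at a site in [n/2, n], and each of
these sets contains a waiting time above (3/4) log n (`add_le_fireTime_one`,
`ae_eventually_exists_log_lt`). The numbers fit since 3/4 < 1 < 3/2 = 2 · 3/4. Thus the first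
burning time increases only up to a multiple of log n, and `eventually_le_mul_log` concludes. -/

namespace ForestFire

/-! ### One site -/

section OneSite

variable {θ : ℝ} {f : ℕ → ℝ}

/-- A tree catches fire not before it appears. -/
lemma le_igniteTime (t : ℝ) : t ≤ igniteTime θ f t := le_max_left _ _

lemma add_mul_le_of_gap (hgap : ∀ i, f i + θ ≤ f (i + 1)) (i : ℕ) : f 0 + i * θ ≤ f i := by
  induction i with
  | zero => simp
  | succ i ih => push_cast; linarith [hgap i]

/-- Ensures that the infimum in `firstActive` is attained and is not the default value `0` of an
empty set. -/
lemma exists_lt_add (hθ : 0 < θ) (hgap : ∀ i, f i + θ ≤ f (i + 1)) (t : ℝ) :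
    ∃ i, t < f i + θ := by
  obtain ⟨n, hn⟩ := exists_nat_gt ((t - f 0) / θ)
  rw [div_lt_iff₀ hθ] at hn
  exact ⟨n, by linarith [add_mul_le_of_gap hgap n]⟩

lemma lt_firstActive_add (hθ : 0 < θ) (hgap : ∀ i, f i + θ ≤ f (i + 1)) (t : ℝ) :
    t < f (firstActive θ f t) + θ :=
  Nat.sInf_mem (exists_lt_add hθ hgap t)

lemma firstActive_le {t : ℝ} {i : ℕ} (h : t < f i + θ) : firstActive θ f t ≤ i :=
  Nat.sInf_le h

lemma lt_firstActive (hθ : 0 < θ) (hgap : ∀ i, f i + θ ≤ f (i + 1)) {t : ℝ} {i : ℕ}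
    (h : f i + θ ≤ t) : i < firstActive θ f t := by
  have hmono : Monotone f := monotone_nat_of_le_succ fun i => by linarith [hgap i]
  by_contra! hle
  linarith [lt_firstActive_add hθ hgap t, hmono hle]

lemma burnStarts_gap {ignite : ℝ → ℝ} (hi : ∀ t, t ≤ ignite t) {w : ℕ → ℝ} (hw : ∀ i, 0 ≤ w i)
    (i : ℕ) : burnStarts θ ignite w i + θ ≤ burnStarts θ ignite w (i + 1) := by
  have := hi (burnStarts θ ignite w i + θ + w (i + 1))
  rw [burnStarts]
  linarith [hw (i + 1)]

end OneSite

/-! ### Times of the fires -/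

section Times

variable {θ : ℝ} {ξ : ℕ → ℕ → ℝ}

lemma fireTime_gap (hξ : ∀ x i, 0 ≤ ξ x i) (x i : ℕ) :
    fireTime θ ξ x i + θ ≤ fireTime θ ξ x (i + 1) := by
  cases x with
  | zero => exact burnStarts_gap (fun t => le_rfl) (hξ 0) i
  | succ x => exact burnStarts_gap le_igniteTime (hξ (x + 1)) i

lemma fireTime_strictMono (hθ : 0 < θ) (hξ : ∀ x i, 0 ≤ ξ x i) (x : ℕ) :
    StrictMono (fireTime θ ξ x) :=
  strictMono_nat_of_lt_succ fun i => by linarith [fireTime_gap (θ := θ) hξ x i]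

lemma fireTime_succ (x i : ℕ) :
    fireTime θ ξ (x + 1) i = igniteTime θ (fireTime θ ξ x) (treeTime θ ξ (x + 1) i) := by
  cases i <;> rfl

lemma treeTime_le_fireTime (x i : ℕ) : treeTime θ ξ x i ≤ fireTime θ ξ x i := by
  cases x with
  | zero => cases i <;> exact le_rfl
  | succ x => rw [fireTime_succ]; exact le_igniteTime _

/-- The number of the fire at `x` from which tree number `i` at `x + 1` is ignited. -/
noncomputable def igniter (θ : ℝ) (ξ : ℕ → ℕ → ℝ) (x i : ℕ) : ℕ :=
  firstActive θ (fireTime θ ξ x) (treeTime θ ξ (x + 1) i)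

lemma fireTime_succ_eq_max (x i : ℕ) : fireTime θ ξ (x + 1) i =
    max (treeTime θ ξ (x + 1) i) (fireTime θ ξ x (igniter θ ξ x i)) :=
  fireTime_succ x i

/-- Burning times are equal, so a tree at x + 1 burns at least until its igniting fire at x is over;
the next tree at x + 1 therefore needs a later fire. -/
lemma igniter_strictMono (hθ : 0 < θ) (hξ : ∀ x i, 0 ≤ ξ x i) (x : ℕ) :
    StrictMono (igniter θ ξ x) := by
  refine strictMono_nat_of_lt_succ fun i => lt_firstActive hθ (fireTime_gap hξ x) ?_
  have h : fireTime θ ξ x (igniter θ ξ x i) ≤ fireTime θ ξ (x + 1) i := by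
    rw [fireTime_succ_eq_max]; exact le_max_right _ _
  change _ ≤ fireTime θ ξ (x + 1) i + θ + ξ (x + 1) (i + 1)
  unfold igniter at h ⊢
  linarith [hξ (x + 1) (i + 1)]

/-- By strict monotonicity the igniter of tree number i has number at least i. -/
lemma fireTime_mono_site (hθ : 0 < θ) (hξ : ∀ x i, 0 ≤ ξ x i) (i : ℕ) :
    Monotone fun x => fireTime θ ξ x i := by
  refine monotone_nat_of_le_succ fun x => ?_
  rw [fireTime_succ_eq_max]
  exact le_max_of_le_right
    ((fireTime_strictMono hθ hξ x).monotone ((igniter_strictMono hθ hξ x).le_apply))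

/-- The second fire at `m` comes after two generations of trees, at possibly different sites. -/
lemma add_le_fireTime_one (hθ : 0 < θ) (hξ : ∀ x i, 0 ≤ ξ x i) {y x m : ℕ} (hyx : y ≤ x)
    (hxm : x ≤ m) : ξ y 0 + ξ x 1 ≤ fireTime θ ξ m 1 := by
  have h0 : ξ y 0 ≤ fireTime θ ξ x 0 :=
    (treeTime_le_fireTime (θ := θ) y 0).trans (fireTime_mono_site hθ hξ 0 hyx)
  have h1 : fireTime θ ξ x 0 + θ + ξ x 1 ≤ fireTime θ ξ m 1 :=
    (treeTime_le_fireTime (θ := θ) x 1).trans (fireTime_mono_site hθ hξ 1 hxm)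
  linarith

/-- If the first tree at `m + 1` is there when `m` burns for the second time, then `m + 1` burns
not later than that. -/
lemma fireTime_succ_zero_le_of_le (hθ : 0 < θ) (hξ : ∀ x i, 0 ≤ ξ x i) {m : ℕ}
    (h : ξ (m + 1) 0 ≤ fireTime θ ξ m 1) : fireTime θ ξ (m + 1) 0 ≤ fireTime θ ξ m 1 := by
  rw [fireTime_succ_eq_max]
  refine max_le h ((fireTime_strictMono hθ hξ m).monotone (firstActive_le ?_))
  change ξ (m + 1) 0 < _
  linarith

lemma igniter_eq_zero {m : ℕ} (h : ξ (m + 1) 0 < fireTime θ ξ m 0 + θ) : igniter θ ξ m 0 = 0 :=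
  Nat.le_zero.1 (firstActive_le h)

lemma fireTime_succ_zero_of_lt {m : ℕ} (h : ξ (m + 1) 0 < fireTime θ ξ m 0 + θ) :
    fireTime θ ξ (m + 1) 0 = max (ξ (m + 1) 0) (fireTime θ ξ m 0) := by
  rw [fireTime_succ_eq_max, igniter_eq_zero h]; rfl

end Times

/-! ### Extents of the fires -/

section Extents

variable {θ : ℝ} {ξ : ℕ → ℕ → ℝ}

lemma fireLabel_succ (x i : ℕ) :
    fireLabel θ ξ (x + 1) i = fireLabel θ ξ x (igniter θ ξ x i) := rfl

lemma fireLabel_strictMono (hθ : 0 < θ) (hξ : ∀ x i, 0 ≤ ξ x i) (x : ℕ) :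
    StrictMono (fireLabel θ ξ x) := by
  induction x with
  | zero => exact strictMono_id
  | succ x ih => exact ih.comp (igniter_strictMono hθ hξ x)

lemma exists_fireLabel_eq_of_le {x y i : ℕ} (h : y ≤ x) :
    ∃ j, fireLabel θ ξ y j = fireLabel θ ξ x i := by
  induction x, h using Nat.le_induction generalizing i with
  | base => exact ⟨i, rfl⟩
  | succ x _ ih => exact ih (i := igniter θ ξ x i)

lemma le_extent (x i : ℕ) : (x : ℕ∞) ≤ extent θ ξ (fireLabel θ ξ x i) :=
  le_sSup ⟨x, i, rfl, rfl⟩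

/-- The fires before the first one that burns `x` stop before `x`. -/
lemma extent_lt (hθ : 0 < θ) (hξ : ∀ x i, 0 ≤ ξ x i) {x k : ℕ} (h : k < fireLabel θ ξ x 0) :
    extent θ ξ k < x := by
  have hx : x ≠ 0 := by rintro rfl; exact absurd h (Nat.not_lt_zero _)
  obtain ⟨x, rfl⟩ := Nat.exists_eq_succ_of_ne_zero hx
  refine lt_of_le_of_lt (sSup_le ?_) (Nat.cast_lt.2 (Nat.lt_succ_self x))
  rintro _ ⟨y, i, rfl, rfl⟩
  by_contra! hlt
  rw [Nat.cast_lt] at hlt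
  -- A fire burning a site beyond x also burns x + 1, so its label is at least the first label
  -- there.
  obtain ⟨j, hj⟩ := exists_fireLabel_eq_of_le (θ := θ) (ξ := ξ) (i := i) (Nat.succ_le_of_lt hlt)
  have := (fireLabel_strictMono hθ hξ (x + 1)).monotone (Nat.zero_le j)
  rw [hj] at this
  exact absurd h (not_lt.2 this)

/-- If the first tree at `m + 1` appears after the first fire at `m` is over, that fire stops
at `m`. -/
lemma extent_eq (hθ : 0 < θ) (hξ : ∀ x i, 0 ≤ ξ x i) {m : ℕ}
    (h : fireTime θ ξ m 0 + θ ≤ ξ (m + 1) 0) : extent θ ξ (fireLabel θ ξ m 0) = m := by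
  refine le_antisymm (Order.le_of_lt_add_one ?_) (le_extent m 0)
  have hlt : fireLabel θ ξ m 0 < fireLabel θ ξ (m + 1) 0 :=
    fireLabel_strictMono hθ hξ m (lt_firstActive hθ (fireTime_gap hξ m) h)
  exact_mod_cast extent_lt hθ hξ hlt

/-- If the first tree at `m + 1` appears after the first fire at `m` is over, then `m` is one of
the successive maxima. -/
lemma exists_succMax_eq (hθ : 0 < θ) (hξ : ∀ x i, 0 ≤ ξ x i) {m : ℕ}
    (h : fireTime θ ξ m 0 + θ ≤ ξ (m + 1) 0) : ∃ i, succMax θ ξ i = m := by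
  have hm := extent_eq hθ hξ h
  have hle : ∀ k ≤ fireLabel θ ξ m 0, extent θ ξ k ≤ m := fun k hk => by
    rcases hk.lt_or_eq with hk | rfl
    exacts [(extent_lt hθ hξ hk).le, hm.le]
  by_contra! hne
  -- While the maxima stay below m, the first fire at m competes for the next one, so they cannot
  -- jump over m. Avoiding m, they would increase strictly below it forever; i = m is absurd.
  have hlt : ∀ i : ℕ, succMax θ ξ i < m ∧ (i : ℕ∞) ≤ succMax θ ξ i := by
    intro i
    induction i with
    | zero => exact ⟨(hle 0 (Nat.zero_le _)).lt_of_ne (hne 0), by simp⟩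
    | succ i ih =>
      have hmem : fireLabel θ ξ m 0 ∈ {k | succMax θ ξ i < extent θ ξ k} := by
        change _ < extent θ ξ _
        rw [hm]; exact ih.1
      have heq : succMax θ ξ (i + 1) =
          extent θ ξ (sInf {k | succMax θ ξ i < extent θ ξ k}) := by
        rw [succMax, if_neg ih.1.ne_top]
      have hgt : succMax θ ξ i < succMax θ ξ (i + 1) := by
        rw [heq]; exact Nat.sInf_mem ⟨_, hmem⟩
      refine ⟨((heq.trans_le (hle _ (Nat.sInf_le hmem)))).lt_of_ne (hne _), ?_⟩
      push_cast
      exact Order.add_one_le_of_lt (ih.2.trans_lt hgt)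
  exact absurd ((hlt m).2.trans_lt (hlt m).1) (lt_irrefl _)

/-- Large sites at which a first fire stops are successive maxima with a large number. -/
lemma eventually_exists_ge_succMax_eq (hθ : 0 < θ) (hξ : ∀ x i, 0 ≤ ξ x i) (κ : ℕ) :
    ∀ᶠ m : ℕ in atTop, fireTime θ ξ m 0 + θ ≤ ξ (m + 1) 0 → ∃ i ≥ κ, succMax θ ξ i = m := by
  have hne : ∀ᶠ m : ℕ in atTop, ∀ i < κ, succMax θ ξ i ≠ m := by
    refine (Set.finite_Iio κ).eventually_all.2 fun i _ => ?_
    -- `toNat` sends `⊤` to `0`, harmlessly: `⊤` differs from every finite m.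
    filter_upwards [eventually_gt_atTop (succMax θ ξ i).toNat] with m hm h
    simp [h] at hm
  filter_upwards [hne] with m hm h
  obtain ⟨i, hi⟩ := exists_succMax_eq hθ hξ h
  exact ⟨i, not_lt.1 fun hlt => hm i hlt hi, hi⟩

end Extents

/-- A sequence whose term after the `n`-th exceeds the `n`-th only if it is at most `c * log n` is
eventually bounded by `c * log n`. -/
lemma eventually_le_mul_log {a : ℕ → ℝ} {c : ℝ} (hc : 0 < c)
    (h : ∀ᶠ n : ℕ in atTop, a (n + 1) ≤ max (a n) (c * Real.log n)) :
    ∀ᶠ n : ℕ in atTop, a n ≤ c * Real.log n := by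
  obtain ⟨N, hN⟩ := eventually_atTop.1 (h.and (eventually_ge_atTop 1))
  have hle : ∀ n ≥ N, a n ≤ max (a N) (c * Real.log n) := by
    intro n hn
    induction n, hn using Nat.le_induction with
    | base => exact le_max_left _ _
    | succ n hn ih =>
      have hlog : c * Real.log n ≤ c * Real.log (n + 1 : ℕ) := by
        have h1 : (0 : ℝ) < n := by exact_mod_cast (hN n hn).2
        gcongr
        simp
      refine (hN n hn).1.trans (max_le (ih.trans (max_le_max le_rfl hlog)) ?_)
      exact le_max_of_le_right hlog
  have hlim : Tendsto (fun n : ℕ => c * Real.log n) atTop atTop :=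
    (Real.tendsto_log_atTop.comp tendsto_natCast_atTop_atTop).const_mul_atTop hc
  filter_upwards [eventually_ge_atTop N, hlim.eventually_ge_atTop (a N)] with n hn ha
  exact (hle n hn).trans (max_le ha le_rfl)

/-! ### Exponential waiting times -/

section Waiting

variable {Ω : Type*} [MeasurableSpace Ω] {P : Measure Ω}

lemma expMeasure_one_Iic {t : ℝ} (ht : 0 ≤ t) :
    expMeasure 1 (Set.Iic t) = ENNReal.ofReal (1 - Real.exp (-t)) := by
  have := isProbabilityMeasure_expMeasure one_pos
  rw [← ofReal_cdf, cdf_expMeasure_eq one_pos, if_pos ht, one_mul]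

lemma expMeasure_one_Ioi {t : ℝ} (ht : 0 ≤ t) :
    expMeasure 1 (Set.Ioi t) = ENNReal.ofReal (Real.exp (-t)) := by
  have := isProbabilityMeasure_expMeasure one_pos
  rw [← Set.compl_Iic, prob_compl_eq_one_sub measurableSet_Iic, expMeasure_one_Iic ht,
    ← ENNReal.ofReal_one, ← ENNReal.ofReal_sub _ (by simpa using ht), sub_sub_cancel]

lemma ae_nonneg_of_hasLaw_expMeasure {X : Ω → ℝ} (hX : HasLaw X (expMeasure 1) P) :
    ∀ᵐ ω ∂P, 0 ≤ X ω := by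
  have h := expMeasure_one_Iic le_rfl
  rw [neg_zero, Real.exp_zero, sub_self, ENNReal.ofReal_zero] at h
  rw [ae_iff]
  have := hX.measure_eq (p := fun x => ¬ 0 ≤ x) measurableSet_Ici.compl
  rw [this]
  exact measure_mono_null (fun x (hx : ¬ 0 ≤ x) => (not_le.1 hx).le) h

/-- Of exponential waiting times, the one with number `n` is eventually below `(3 / 2) * log n`. -/
lemma ae_eventually_le_log {X : ℕ → Ω → ℝ} (hX : ∀ n, HasLaw (X n) (expMeasure 1) P) :
    ∀ᵐ ω ∂P, ∀ᶠ n : ℕ in atTop, X n ω ≤ 3 / 2 * Real.log n := by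
  have hprob : ∀ n : ℕ, P {ω | 3 / 2 * Real.log n < X n ω} =
      ENNReal.ofReal (Real.exp (-(3 / 2 * Real.log n))) := fun n =>
    ((hX n).measure_eq measurableSet_Ioi).trans
      (expMeasure_one_Ioi (mul_nonneg (by norm_num) (Real.log_natCast_nonneg n)))
  have hsum : Summable fun n : ℕ => Real.exp (-(3 / 2 * Real.log n)) := by
    refine (Real.summable_nat_rpow_inv (p := 3 / 2).2 (by norm_num)).congr_atTop ?_
    filter_upwards [eventually_gt_atTop 0] with n hn
    rw [Real.rpow_def_of_pos (by exact_mod_cast hn), ← Real.exp_neg, mul_comm]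
  have := ae_eventually_notMem (μ := P) (s := fun n : ℕ => {ω | 3 / 2 * Real.log n < X n ω})
    (by simp only [hprob]; exact hsum.tsum_ofReal_ne_top)
  filter_upwards [this] with ω hω
  filter_upwards [hω] with n hn
  exact not_lt.1 hn

/-- The probability that all of a finite number of independent exponential waiting times are at most
`t` is at most `exp (-N * exp (-t))`, `N` being their number. -/
lemma measure_forall_le {ι : Type*} {X : ι → Ω → ℝ} (hX : ∀ p, HasLaw (X p) (expMeasure 1) P)
    (hindep : iIndepFun X P) (S : Finset ι) {t : ℝ} (ht : 0 ≤ t) :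
    P {ω | ∀ p ∈ S, X p ω ≤ t} ≤ ENNReal.ofReal (Real.exp (-(S.card * Real.exp (-t)))) := by
  have h := hindep.measure_inter_preimage_eq_mul S (sets := fun _ => Set.Iic t)
    (fun _ _ => measurableSet_Iic)
  have hset : {ω | ∀ p ∈ S, X p ω ≤ t} = ⋂ p ∈ S, X p ⁻¹' Set.Iic t := by
    ext ω; simp
  have hprob : ∀ p, P (X p ⁻¹' Set.Iic t) = ENNReal.ofReal (1 - Real.exp (-t)) := fun p =>
    ((hX p).measure_eq measurableSet_Iic).trans (expMeasure_one_Iic ht)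
  have h1 : 0 ≤ 1 - Real.exp (-t) := by simpa using ht
  rw [hset, h, Finset.prod_congr rfl fun p _ => hprob p, Finset.prod_const,
    ← ENNReal.ofReal_pow h1, ← mul_neg, Real.exp_nat_mul]
  gcongr
  exact Real.one_sub_le_exp_neg _

/-- With z = n^(1/4) / 2, the bound exp z ≥ z^8 / 8! gives order n^2, which makes the probabilities
summable. -/
lemma exp_neg_le_inv_sq {n N : ℕ} (hn : 0 < n) (hN : n ≤ 2 * N) :
    Real.exp (-(N * Real.exp (-(3 / 4 * Real.log n)))) ≤
      Nat.factorial 8 * 256 * ((n : ℝ) ^ 2)⁻¹ := by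
  have hn' : (0 : ℝ) < n := by exact_mod_cast hn
  have hN' : (n : ℝ) / 2 ≤ N := by
    have : (n : ℝ) ≤ 2 * N := by exact_mod_cast hN
    linarith
  set z : ℝ := n / 2 * Real.exp (-(3 / 4 * Real.log n)) with hz
  have hz0 : 0 < z := by positivity
  have hz8 : z ^ 8 = n ^ 2 / 256 := by
    have : Real.exp (-(3 / 4 * Real.log n)) ^ 8 = ((n : ℝ) ^ 6)⁻¹ := by
      rw [← Real.exp_nat_mul, ← Real.exp_log (pow_pos hn' 6), ← Real.exp_neg, Real.log_pow]
      congr 1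
      push_cast
      ring
    rw [hz, mul_pow, this]
    field_simp
    norm_num
  have hexp : Real.exp (-(N * Real.exp (-(3 / 4 * Real.log n)))) ≤ Real.exp (-z) := by
    rw [hz]; gcongr
  refine hexp.trans ?_
  rw [Real.exp_neg]
  refine (inv_anti₀ (by positivity) (Real.pow_div_factorial_le_exp z hz0.le 8)).trans_eq ?_
  rw [hz8]
  field_simp

/-- If `S n` is a set of at least `n / 2` indices, one of the waiting times with index in `S n`
eventually exceeds `(3 / 4) * log n`. -/
lemma ae_eventually_exists_log_lt {ι : Type*} {X : ι → Ω → ℝ}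
    (hX : ∀ p, HasLaw (X p) (expMeasure 1) P) (hindep : iIndepFun X P) (S : ℕ → Finset ι)
    (hS : ∀ n, n ≤ 2 * (S n).card) :
    ∀ᵐ ω ∂P, ∀ᶠ n : ℕ in atTop, ∃ p ∈ S n, 3 / 4 * Real.log n < X p ω := by
  have hsum : Summable fun n : ℕ =>
      Real.exp (-((S n).card * Real.exp (-(3 / 4 * Real.log n)))) := by
    have h2 : Summable fun n : ℕ => (Nat.factorial 8 * 256 * ((n : ℝ) ^ 2)⁻¹ : ℝ) :=
      (Real.summable_nat_pow_inv.2 one_lt_two).mul_left _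
    refine Summable.of_norm_bounded_eventually_nat h2 ?_
    filter_upwards [eventually_gt_atTop 0] with n hn
    rw [Real.norm_of_nonneg (Real.exp_pos _).le]
    exact exp_neg_le_inv_sq hn (hS n)
  have := ae_eventually_notMem (μ := P)
    (s := fun n : ℕ => {ω | ∀ p ∈ S n, X p ω ≤ 3 / 4 * Real.log n})
    (ne_top_of_le_ne_top hsum.tsum_ofReal_ne_top (ENNReal.tsum_le_tsum fun n =>
      measure_forall_le hX hindep (S n)
        (mul_nonneg (by norm_num) (Real.log_natCast_nonneg n))))
  filter_upwards [this] with ω hω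
  filter_upwards [hω] with n hn
  simpa using hn

end Waiting

end ForestFire

theorem mainTheorem8 {Ω : Type*} [MeasurableSpace Ω] (P : Measure Ω) [IsProbabilityMeasure P]
    (θ : ℝ) (hθ : 0 < θ) (ξ : ℕ → ℕ → Ω → ℝ)
    (hlaw : ∀ x i, HasLaw (ξ x i) (expMeasure 1) P)
    (hindep : iIndepFun (fun p : ℕ × ℕ => ξ p.1 p.2) P)
    (hconj : ForestFire.SecondFireConjecture P θ ξ) :
    ∃ M : ℝ, 0 < M ∧ ∀ᵐ ω ∂P, ∀ᶠ n : ℕ in atTop,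
      ForestFire.fireTime θ (fun x j => ξ x j ω) n 0 ≤ M * Real.log n := by
  obtain ⟨c, hc, hconj⟩ := hconj
  -- Any constant that is at least c and at least 3/2 would do.
  refine ⟨c + 2, by linarith, ?_⟩
  have hnonneg : ∀ᵐ ω ∂P, ∀ x i, 0 ≤ ξ x i ω :=
    ae_all_iff.2 fun x => ae_all_iff.2 fun i =>
      ForestFire.ae_nonneg_of_hasLaw_expMeasure (hlaw x i)
  have hX : ∀ p : ℕ × ℕ, HasLaw (ξ p.1 p.2) (expMeasure 1) P := fun p => hlaw p.1 p.2
  -- First trees are taken from the left half and second trees from the right half, so that the two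
  -- sites are in the order that `add_le_fireTime_one` requires.
  have hfst := ForestFire.ae_eventually_exists_log_lt hX hindep
    (fun n => Finset.Icc 0 (n / 2) ×ˢ {0}) (fun n => by simp; omega)
  have hsnd := ForestFire.ae_eventually_exists_log_lt hX hindep
    (fun n => Finset.Icc (n / 2) n ×ˢ {1}) (fun n => by simp; omega)
  have hnext := ForestFire.ae_eventually_le_log (X := fun n => ξ (n + 1) 0) (P := P)
    fun n => hlaw (n + 1) 0
  filter_upwards [hconj, hnonneg, hfst, hsnd, hnext] with ω ⟨κ, hκ⟩ hξ hfst hsnd hnext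
  refine ForestFire.eventually_le_mul_log (by linarith) ?_
  filter_upwards [hfst, hsnd, hnext, ForestFire.eventually_exists_ge_succMax_eq hθ hξ κ]
    with n ⟨p, hp, hlp⟩ ⟨q, hq, hlq⟩ hn hmax
  simp only [Finset.mem_product, Finset.mem_Icc, Finset.mem_singleton] at hp hq
  rw [hp.2] at hlp
  rw [hq.2] at hlq
  have hlog := Real.log_natCast_nonneg n
  have hclog : 0 ≤ c * Real.log n := mul_nonneg (by linarith) hlog
  rcases lt_or_ge (ξ (n + 1) 0 ω) (ForestFire.fireTime θ (fun x j => ξ x j ω) n 0 + θ)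
    with hlt | hge
  · rw [ForestFire.fireTime_succ_zero_of_lt hlt]
    refine max_le (le_max_of_le_right ?_) (le_max_left _ _)
    linarith
  · obtain ⟨i, hi, him⟩ := hmax hge
    have hadd := ForestFire.add_le_fireTime_one hθ hξ (hp.1.2.trans hq.1.1) hq.1.2
    refine le_max_of_le_right ((ForestFire.fireTime_succ_zero_le_of_le hθ hξ ?_).trans
      ((hκ i hi n him).trans ?_)) <;> linarith
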